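/- For $\sigma=\sigma_1\cdots\sigma_n\in S_n$ let $\mathrm{des}(\sigma)=|\{i:\sigma_i>\sigma_{i+1}\}|$ and $\mathrm{inv}(\sigma)=|\{(i,j): i<j,\ \sigma_i>\sigma_j\}|$. For $\tau\in S_p$, a $\tau$-match in $\sigma$ is a position $i$ with $1\le i\le n-p+1$ such that $\sigma_i\sigma_{i+1}\cdots\sigma_{i+p-1}$ has reduction $\tau$ (the reduction replaces the $k$-th smallest letter by $k$ for each $k$). Let $\mathcal{NM}_n(\tau)$ be the set of $\sigma\in S_n$ without $\tau$-matches. For $p\ge 3$, $\tau\in S_p$ is called minimal overlapping if the smallest $i$ for which some $\sigma\in S_i$ has exactly two $\tau$-matches is $i=2p-1$. Let $[n]_q=1+q+\cdots+q^{n-1}$, $[n]_q!=[1]_q\cdots[n]_q$, and $\binom{n}{k}_q=\frac{[n]_q!}{[k]_q!\,[n-k]_q!}$ for $0\le k\le n$, and $\binom{n}{k}_q=0$ for $k>n$ (also when $n<0$). With $q,z$ indeterminates, define the formal power series in $t$ over $\mathbb{Q}(q,z)$ $$\mathrm{INM}_\tau(t,q,z)=1+\sum_{n\ge1}\frac{t^n}{[n]_q!}\sum_{\sigma\in\mathcal{NM}_n(\tau)}z^{\mathrm{des}(\sigma)+1}q^{\mathrm{inv}(\sigma)}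 .$$ **Theorem.** Let $\tau=\tau_1\cdots\tau_p\in S_p$ be minimal overlapping with $\tau_1=1$ and $\tau_p=s$, where $2\le s<p$. Then $$\mathrm{INM}_\tau(t,q,z)=\frac{1}{\mathrm{IU}_\tau(t,q,z)},\qquad \mathrm{IU}_\tau(t,q,z)=1+\sum_{n\ge1}\mathrm{IU}_{\tau,n}(q,z)\frac{t^n}{[n]_q!},$$ where $\mathrm{IU}_{\tau,1}(q,z)=-z$ and, for all $n\ge2$, $$\mathrm{IU}_{\tau,n}(q,z)=(1-z)\,\mathrm{IU}_{\tau,n-1}(q,z)-z^{\mathrm{des}(\tau)}q^{\mathrm{inv}(\tau)}\binom{n-s}{p-s}_q\mathrm{IU}_{\tau,n-p+1}(q,z),$$ the last term being $0$ for $n<p$. -/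

import Mathlib

/-!
A permutation `σ₁ ⋯ σₙ` of `{1, …, n}` is modelled by `σ : Equiv.Perm (Fin n)`; positions and
values are both shifted down by one, so that `σ_{i+1} = (σ i : ℕ) + 1`.
-/

namespace MinOverlap

/-- The descent number `des σ = #{i : σ_i > σ_{i+1}}`. -/
def des {n : ℕ} (σ : Equiv.Perm (Fin n)) : ℕ :=
  (Finset.univ.filter fun i : Fin n => ∃ h : (i : ℕ) + 1 < n, σ ⟨(i : ℕ) + 1, h⟩ < σ i).card

/-- The inversion number `inv σ = #{(i, j) : i < j, σ_i > σ_j}`. -/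
def inv {n : ℕ} (σ : Equiv.Perm (Fin n)) : ℕ :=
  (Finset.univ.filter fun x : Fin n × Fin n => x.1 < x.2 ∧ σ x.2 < σ x.1).card

/-- The reduction of a word with distinct letters: the `i`-th smallest letter is replaced by `i`
(counted from `0`), i.e. each letter is replaced by the number of smaller letters. -/
def red {p : ℕ} (w : Fin p → ℕ) : Fin p → ℕ :=
  fun a => (Finset.univ.filter fun b : Fin p => w b < w a).card

/-- There is a `τ`-match in `σ` starting at the (0-based) position `i`: the `p` consecutive letters
of `σ` starting there exist and their reduction is `τ`. -/
def IsMatchAt {p n : ℕ} (τ : Equiv.Perm (Fin p)) (σ : Equiv.Perm (Fin n)) (i : ℕ) : Prop :=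
  ∃ h : i + p ≤ n,
    ∀ a : Fin p, red (fun b : Fin p => (σ ⟨i + (b : ℕ), by omega⟩ : ℕ)) a = (τ a : ℕ)

instance {p n : ℕ} (τ : Equiv.Perm (Fin p)) (σ : Equiv.Perm (Fin n)) (i : ℕ) :
    Decidable (IsMatchAt τ σ i) := by
  unfold IsMatchAt; infer_instance

/-- `τ-mch(σ)`, the number of `τ`-matches in `σ`. -/
def mch {p n : ℕ} (τ : Equiv.Perm (Fin p)) (σ : Equiv.Perm (Fin n)) : ℕ :=
  ((Finset.range (n + 1)).filter fun i => IsMatchAt τ σ i).card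

/-- `τ ∈ S_p`, `p ≥ 3`, is minimal overlapping if the smallest `i` such that some `σ ∈ S_i` has
exactly two `τ`-matches is `2p - 1`. -/
def IsMinimalOverlapping {p : ℕ} (τ : Equiv.Perm (Fin p)) : Prop :=
  3 ≤ p ∧ IsLeast {i : ℕ | ∃ σ : Equiv.Perm (Fin i), mch τ σ = 2} (2 * p - 1)

/-- `NM_n(τ)`: the permutations of length `n` without `τ`-matches. -/
def NM {p : ℕ} (τ : Equiv.Perm (Fin p)) (n : ℕ) : Finset (Equiv.Perm (Fin n)) :=
  Finset.univ.filter fun σ => ∀ i : ℕ, i ≤ n → ¬ IsMatchAt τ σ i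

/-- The field `ℚ(q, z)` of rational functions in two indeterminates. -/
abbrev K : Type := FractionRing (MvPolynomial (Fin 2) ℚ)

/-- The indeterminate `q`. -/
noncomputable def q : K := algebraMap (MvPolynomial (Fin 2) ℚ) K (MvPolynomial.X 0)

/-- The indeterminate `z`. -/
noncomputable def z : K := algebraMap (MvPolynomial (Fin 2) ℚ) K (MvPolynomial.X 1)

/-- `[n]_q = 1 + q + ⋯ + q^{n-1}`. -/
noncomputable def qInt (n : ℕ) : K := ∑ i ∈ Finset.range n, q ^ i

/-- `[n]_q! = [1]_q [2]_q ⋯ [n]_q`. -/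
noncomputable def qFactorial (n : ℕ) : K := ∏ i ∈ Finset.range n, qInt (i + 1)

/-- The `q`-binomial coefficient `[n]_q! / ([k]_q! [n-k]_q!)`, which is `0` for `k > n`. -/
noncomputable def qBinom (n k : ℕ) : K :=
  if k ≤ n then qFactorial n / (qFactorial k * qFactorial (n - k)) else 0

/-- `INM_{τ,n}(q,z) = ∑_{σ ∈ NM_n(τ)} z^{des σ + 1} q^{inv σ}`. -/
noncomputable def INMcoeff {p : ℕ} (τ : Equiv.Perm (Fin p)) (n : ℕ) : K :=
  ∑ σ ∈ NM τ n, z ^ (des σ + 1) * q ^ inv σ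

/-- `INM_τ(t,q,z) = 1 + ∑_{n ≥ 1} INM_{τ,n}(q,z) tⁿ / [n]_q!`, a power series in `t`. -/
noncomputable def INM {p : ℕ} (τ : Equiv.Perm (Fin p)) : PowerSeries K :=
  PowerSeries.mk fun n => if n = 0 then 1 else INMcoeff τ n / qFactorial n

/-- `IU_τ(t,q,z) = 1 / INM_τ(t,q,z)`; the constant term of `INM_τ` is `1`, so this is a genuine
multiplicative inverse. -/
noncomputable def IU {p : ℕ} (τ : Equiv.Perm (Fin p)) : PowerSeries K := (INM τ)⁻¹

/-- `IU_{τ,n}(q,z)`, the coefficient of `tⁿ / [n]_q!` in `IU_τ(t,q,z)`. -/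
noncomputable def IUcoeff {p : ℕ} (τ : Equiv.Perm (Fin p)) (n : ℕ) : K :=
  qFactorial n * PowerSeries.coeff n (IU τ)

end MinOverlap

/-! Permutations become words with distinct letters, and `wsum S f` sums `q ^ inv * f` over the
arrangements of `S`. For functions of the relative order alone, multiplying series in `t ^ n /
[n]_q!` amounts to cutting words into a prefix and a suffix (`wsum_take_mul_drop`). The inverse of
`INM` is built combinatorially, in the manner of the cluster method. `chainWeight` sums over chains
of links that share one letter: an ascent has weight `1 - z`, an occurrence of `τ` has weight `-z ^
des τ`, and the final letter has weight `-z`. For each nonempty word with distinct letters, the sum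
over all cuts of `chainWeight` of the prefix times `nmWeight` of the suffix is zero
(`sum_chainWeight_mul_nmWeight`). This rests on two occurrences of `τ` sharing at most one letter
(`IsMinimalOverlapping.nonOverlapping`). Hence `IUcoeff τ n` is the sum of `chainWeight` over the
arrangements of `range n`. The recursion comes from the first link. Since `τ` starts with its
minimum, a word with nonzero chain weight starts with its smallest letter. An ascent link therefore
removes the letter `0`. A `τ` link ends at a letter of rank `s - 1` in its letter set that must lie
below everything still to come, so the link contains the `s` smallest letters. Choosing its other `p
- s` letters yields the `q`-binomial coefficient (`wsum_match`). -/

namespace MinOverlap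

open Finset

/-! ### Arrangements of a finite set, and inversions across a cut. -/

/-- The words in which every element of `S` occurs exactly once. -/
noncomputable def arr (S : Finset ℕ) : Finset (List ℕ) := S.toList.permutations.toFinset

theorem mem_arr {S : Finset ℕ} {w : List ℕ} : w ∈ arr S ↔ w.Nodup ∧ w.toFinset = S := by
  rw [arr, List.mem_toFinset, List.mem_permutations]
  constructor
  · intro h
    exact ⟨h.nodup_iff.2 S.nodup_toList, by rw [List.toFinset_eq_of_perm _ _ h, S.toList_toFinset]⟩
  · rintro ⟨h1, rfl⟩
    exact (List.toFinset_toList h1).symm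

theorem length_of_mem_arr {S : Finset ℕ} {w : List ℕ} (h : w ∈ arr S) : w.length = #S := by
  obtain ⟨h1, rfl⟩ := mem_arr.1 h
  rw [List.toFinset_card_of_nodup h1]

theorem mem_iff_of_mem_arr {S : Finset ℕ} {w : List ℕ} (h : w ∈ arr S) (x : ℕ) :
    x ∈ w ↔ x ∈ S := by
  obtain ⟨h1, rfl⟩ := mem_arr.1 h
  simp

@[simp] theorem arr_empty : arr ∅ = {[]} := by
  ext w
  rw [mem_arr]
  constructor
  · rintro ⟨-, h⟩
    simpa using h
  · intro h
    rw [Finset.mem_singleton] at h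
    simp [h]

theorem arr_singleton (x : ℕ) : arr {x} = {[x]} := by
  ext w
  rw [Finset.mem_singleton]
  constructor
  · intro h
    have h1 := length_of_mem_arr h
    rw [card_singleton] at h1
    obtain ⟨y, rfl⟩ := List.length_eq_one_iff.1 h1
    have := (mem_iff_of_mem_arr h y).1 (by simp)
    simp_all
  · rintro rfl
    simp [mem_arr]

/-- Cutting the arrangements of `S` after `k` letters. -/
theorem sum_arr_split {M : Type*} [AddCommMonoid M] (S : Finset ℕ) (k : ℕ) (hk : k ≤ #S)
    (G : List ℕ → List ℕ → M) :
    ∑ w ∈ arr S, G (w.take k) (w.drop k) =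
      ∑ C ∈ powersetCard k S, ∑ x ∈ arr C, ∑ y ∈ arr (S \ C), G x y := by
  simp_rw [Finset.sum_sigma']
  refine Finset.sum_bij' (fun w _ => ⟨(w.take k).toFinset, w.take k, w.drop k⟩)
    (fun t _ => t.2.1 ++ t.2.2) ?_ ?_ ?_ ?_ ?_
  · intro w hw
    obtain ⟨hn, hS⟩ := mem_arr.1 hw
    have hl := length_of_mem_arr hw
    have h1 : (w.take k).Nodup := hn.sublist (List.take_sublist _ _)
    have h2 : (w.drop k).Nodup := hn.sublist (List.drop_sublist _ _)
    have h3 : List.Disjoint (w.take k) (w.drop k) := by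
      rw [← List.take_append_drop k w] at hn
      exact List.disjoint_of_nodup_append hn
    simp only [Finset.mem_sigma, mem_powersetCard]
    refine ⟨⟨?_, ?_⟩, ?_, ?_⟩
    · rw [← hS]
      intro x hx
      rw [List.mem_toFinset] at hx ⊢
      exact List.mem_of_mem_take hx
    · rw [List.toFinset_card_of_nodup h1, List.length_take]
      omega
    · exact mem_arr.2 ⟨h1, rfl⟩
    · refine mem_arr.2 ⟨h2, ?_⟩
      ext x
      rw [← hS, Finset.mem_sdiff, List.mem_toFinset, List.mem_toFinset, List.mem_toFinset]
      constructor
      · exact fun hx => ⟨List.mem_of_mem_drop hx, fun h => h3 h hx⟩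
      · rintro ⟨hx, hx'⟩
        rw [← List.take_append_drop k w, List.mem_append] at hx
        exact hx.resolve_left hx'
  · rintro ⟨C, x, y⟩ h
    simp only [Finset.mem_sigma, mem_powersetCard] at h
    obtain ⟨⟨hC, -⟩, hx, hy⟩ := h
    refine mem_arr.2 ⟨?_, ?_⟩
    · refine List.Nodup.append (mem_arr.1 hx).1 (mem_arr.1 hy).1 ?_
      intro a ha hb
      rw [mem_iff_of_mem_arr hx] at ha
      rw [mem_iff_of_mem_arr hy, Finset.mem_sdiff] at hb
      exact hb.2 ha
    · rw [List.toFinset_append, (mem_arr.1 hx).2, (mem_arr.1 hy).2]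
      exact Finset.union_sdiff_of_subset hC
  · intro w _
    simp
  · rintro ⟨C, x, y⟩ h
    simp only [Finset.mem_sigma, mem_powersetCard] at h
    obtain ⟨⟨hC, hc⟩, hx, hy⟩ := h
    have hl : x.length = k := by rw [length_of_mem_arr hx, hc]
    have hxC := (mem_arr.1 hx).2
    subst hl hxC
    simp
  · intro w _
    rfl

/-- The number of inversions of a word. -/
def invL : List ℕ → ℕ
  | [] => 0
  | x :: w => w.countP (· < x) + invL w

/-- The number of pairs `(c, d) ∈ C × D` with `d < c`. -/
def cross (C D : Finset ℕ) : ℕ := ∑ c ∈ C, #(D.filter (· < c))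

theorem countP_of_mem_arr {S : Finset ℕ} {w : List ℕ} (h : w ∈ arr S) (x : ℕ) :
    w.countP (· < x) = #(S.filter (· < x)) := by
  obtain ⟨h1, rfl⟩ := mem_arr.1 h
  rw [List.countP_eq_length_filter, ← List.toFinset_card_of_nodup (h1.filter _),
    List.toFinset_filter]
  simp

theorem invL_append_of_mem_arr {C D : Finset ℕ} {x y : List ℕ} (hx : x ∈ arr C)
    (hy : y ∈ arr D) : invL (x ++ y) = cross C D + invL x + invL y := by
  obtain ⟨h1, rfl⟩ := mem_arr.1 hx
  clear hx
  induction x with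
  | nil => simp [cross, invL]
  | cons a x ih =>
    rw [List.nodup_cons] at h1
    have h2 := ih h1.2
    have h3 : cross (a :: x).toFinset D = #(D.filter (· < a)) + cross x.toFinset D := by
      rw [cross, List.toFinset_cons, Finset.sum_insert (by simpa using h1.1), cross]
    rw [List.cons_append, invL, invL, h2, h3, List.countP_append, countP_of_mem_arr hy]
    ring

/-- The sum of `q ^ inv w * f w` over all arrangements `w` of `S`. -/
noncomputable def wsum (S : Finset ℕ) (f : List ℕ → K) : K := ∑ w ∈ arr S, q ^ invL w * f w

/-- An inversion of a concatenation lies in one of the two parts or across the cut, and the number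
across depends only on the two letter sets. -/
theorem wsum_split (S : Finset ℕ) (k : ℕ) (hk : k ≤ #S) (G : List ℕ → List ℕ → K) :
    wsum S (fun w => G (w.take k) (w.drop k)) =
      ∑ C ∈ powersetCard k S, q ^ cross C (S \ C) *
        wsum C (fun x => wsum (S \ C) (fun y => G x y)) := by
  have := sum_arr_split S k hk (fun x y => q ^ invL (x ++ y) * G x y)
  simp only [List.take_append_drop] at this
  rw [wsum, this]
  refine Finset.sum_congr rfl fun C _ => ?_
  simp only [wsum, Finset.mul_sum]
  refine Finset.sum_congr rfl fun x hx => Finset.sum_congr rfl fun y hy => ?_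
  rw [invL_append_of_mem_arr hx hy, pow_add, pow_add]
  ring

/-! ### Order-invariant functions and standardization. -/

/-- A function on words that depends only on the relative order of the letters. -/
def OrderInvariant {M : Type*} (f : List ℕ → M) : Prop :=
  ∀ (w : List ℕ) (φ : ℕ → ℕ), StrictMonoOn φ {x | x ∈ w} → f (w.map φ) = f w

theorem orderInvariant_invL : OrderInvariant invL := by
  intro w φ h
  induction w with
  | nil => rfl
  | cons a w ih =>
    rw [List.map_cons, invL, invL, ih (h.mono fun x hx => List.mem_cons_of_mem _ hx),
      List.countP_map]
    congr 1
    refine List.countP_congr fun x hx => ?_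
    simp [h.lt_iff_lt (a := x) (b := a) (List.mem_cons_of_mem _ hx) (by simp)]

theorem map_mem_arr_image {S : Finset ℕ} {φ : ℕ → ℕ} (hφ : Set.InjOn φ S) {w : List ℕ}
    (hw : w ∈ arr S) : w.map φ ∈ arr (S.image φ) := by
  refine mem_arr.2 ⟨List.Nodup.map_on ?_ (mem_arr.1 hw).1, ?_⟩
  · intro x hx y hy hxy
    rw [mem_iff_of_mem_arr hw] at hx hy
    exact hφ hx hy hxy
  · ext x
    simp [mem_iff_of_mem_arr hw]

theorem wsum_image {S : Finset ℕ} {φ : ℕ → ℕ} (hφ : StrictMonoOn φ S) {f : List ℕ → K}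
    (hf : OrderInvariant f) : wsum (S.image φ) f = wsum S f := by
  symm
  refine Finset.sum_bij (fun w _ => w.map φ) (fun w hw => map_mem_arr_image hφ.injOn hw) ?_ ?_ ?_
  · intro w hw v hv h
    have key : ∀ w ∈ arr S, (w.map φ).map (Function.invFunOn φ S) = w := fun w hw => by
      rw [List.map_map]
      conv_rhs => rw [← List.map_id w]
      exact List.map_congr_left fun y hy =>
        hφ.injOn.leftInvOn_invFunOn ((mem_iff_of_mem_arr hw y).1 hy)
    rw [← key w hw, ← key v hv]
    exact congrArg _ h
  · intro v hv
    have hm : ∀ y ∈ v, ∃ x ∈ S, φ x = y := fun y hy => by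
      simpa using (mem_iff_of_mem_arr hv y).1 hy
    choose! ψ hψ hψ' using hm
    have hv' : (v.map ψ).map φ = v := by
      rw [List.map_map]
      conv_rhs => rw [← List.map_id v]
      exact List.map_congr_left fun y hy => hψ' y hy
    refine ⟨v.map ψ, mem_arr.2 ⟨?_, ?_⟩, hv'⟩
    · have := (mem_arr.1 hv).1
      rw [← hv'] at this
      exact this.of_map _
    · ext x
      simp only [List.mem_toFinset, List.mem_map]
      constructor
      · rintro ⟨y, hy, rfl⟩
        exact hψ y hy
      · intro hx
        have hy : φ x ∈ v := (mem_iff_of_mem_arr hv _).2 (Finset.mem_image_of_mem _ hx)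
        exact ⟨φ x, hy, hφ.injOn (hψ _ hy) hx (hψ' _ hy)⟩
  · intro w hw
    have h : StrictMonoOn φ {x | x ∈ w} := hφ.mono fun x hx => (mem_iff_of_mem_arr hw x).1 hx
    rw [orderInvariant_invL w φ h, hf w φ h]

/-- The rank function of `S`. -/
def rank (S : Finset ℕ) (x : ℕ) : ℕ := #(S.filter (· < x))

theorem strictMonoOn_rank (S : Finset ℕ) : StrictMonoOn (rank S) S := by
  intro x hx y _ hxy
  refine Finset.card_lt_card ?_
  rw [Finset.ssubset_iff_of_subset]
  · exact ⟨x, by simpa using ⟨hx, hxy⟩, by simp⟩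
  · intro a ha
    rw [Finset.mem_filter] at ha ⊢
    exact ⟨ha.1, ha.2.trans hxy⟩

theorem image_rank (S : Finset ℕ) : S.image (rank S) = range #S := by
  refine Finset.eq_of_subset_of_card_le ?_ ?_
  · intro y hy
    obtain ⟨x, hx, rfl⟩ := Finset.mem_image.1 hy
    rw [Finset.mem_range]
    refine Finset.card_lt_card ?_
    rw [Finset.ssubset_iff_of_subset (Finset.filter_subset _ _)]
    exact ⟨x, hx, by simp⟩
  · rw [Finset.card_image_of_injOn (strictMonoOn_rank S).injOn, card_range]

/-- This makes the inner sums of `wsum_split` independent of the chosen letters, so that only their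
number matters. -/
theorem wsum_eq_range (S : Finset ℕ) {f : List ℕ → K} (hf : OrderInvariant f) :
    wsum S f = wsum (range #S) f := by
  rw [← image_rank, wsum_image (strictMonoOn_rank S) hf]

/-! ### `q`-factorials and `q`-binomial coefficients as inversion sums. -/

theorem qInt_ne_zero (n : ℕ) : qInt (n + 1) ≠ 0 := by
  intro h
  have h2 : qInt (n + 1) = algebraMap (MvPolynomial (Fin 2) ℚ) K
      (∑ i ∈ range (n + 1), MvPolynomial.X 0 ^ i) := by
    simp [qInt, q]
  rw [h2, ← map_zero (algebraMap (MvPolynomial (Fin 2) ℚ) K)] at h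
  -- At `q = 1` the polynomial takes the value `n + 1`, which is nonzero in `ℚ`.
  have h3 := congrArg (MvPolynomial.eval fun _ => (1 : ℚ))
    (IsFractionRing.injective (MvPolynomial (Fin 2) ℚ) K h)
  simp at h3
  norm_cast at h3

theorem qFactorial_ne_zero (n : ℕ) : qFactorial n ≠ 0 :=
  Finset.prod_ne_zero_iff.2 fun i _ => qInt_ne_zero i

theorem orderInvariant_const {M : Type*} (c : M) : OrderInvariant fun _ => c :=
  fun _ _ _ => rfl

/-- Sorting the arrangements of `S` by their first letter. -/
theorem wsum_cons {S : Finset ℕ} (hS : S.Nonempty) (f : List ℕ → K) :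
    wsum S f = ∑ x ∈ S, q ^ rank S x * wsum (S.erase x) (fun y => f (x :: y)) := by
  have h := wsum_split S 1 hS.card_pos (fun x y => f (x ++ y))
  simp only [List.take_append_drop] at h
  rw [h, powersetCard_one, sum_map]
  refine Finset.sum_congr rfl fun x _ => ?_
  have h2 : cross {x} (S \ {x}) = rank S x := by
    rw [cross, sum_singleton, rank]
    congr 1
    ext y
    simp
    omega
  simp only [Function.Embedding.coeFn_mk]
  rw [h2, Finset.sdiff_singleton_eq_erase, wsum, arr_singleton]
  simp [invL]

theorem rank_range {n x : ℕ} (h : x ≤ n) : rank (range n) x = x := by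
  rw [rank]
  convert card_range x using 2
  ext y
  simp
  omega

/-- A first letter of rank `x` accounts for exactly `x` inversions, so each letter added to the set
contributes a factor `qInt`. -/
theorem wsum_one (S : Finset ℕ) : wsum S (fun _ => 1) = qFactorial #S := by
  rw [wsum_eq_range S (orderInvariant_const 1)]
  induction #S with
  | zero => simp [wsum, invL, qFactorial]
  | succ n ih =>
    rw [wsum_cons (by simp), qFactorial, prod_range_succ, ← qFactorial, qInt, Finset.mul_sum]
    refine Finset.sum_congr rfl fun x hx => ?_
    rw [wsum_eq_range _ (orderInvariant_const 1), card_erase_of_mem hx, card_range,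
      Nat.add_sub_cancel, ih, rank_range (Finset.mem_range.1 hx).le, mul_comm]

/-- The inversion sum over all arrangements of `S` is evaluated twice: directly, and after a cut
behind the `k`-th letter. -/
theorem sum_cross (S : Finset ℕ) (k : ℕ) :
    ∑ C ∈ powersetCard k S, q ^ cross C (S \ C) = qBinom #S k := by
  rw [qBinom]
  split_ifs with hk
  · have h := wsum_split S k hk (fun _ _ => 1)
    rw [wsum_one] at h
    rw [h, eq_div_iff (mul_ne_zero (qFactorial_ne_zero _) (qFactorial_ne_zero _)), Finset.sum_mul]
    refine Finset.sum_congr rfl fun C hC => ?_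
    obtain ⟨hCS, hc⟩ := mem_powersetCard.1 hC
    rw [wsum_one, Finset.card_sdiff_of_subset hCS, hc]
    have : wsum C (fun _ => qFactorial (#S - k)) = qFactorial k * qFactorial (#S - k) := by
      rw [← hc, ← wsum_one C, wsum, wsum, Finset.sum_mul]
      simp
    rw [this]
  · rw [powersetCard_eq_empty.2 (by omega), sum_empty]

theorem wsum_mul_const (S : Finset ℕ) (f : List ℕ → K) (c : K) :
    wsum S (fun w => f w * c) = wsum S f * c := by
  simp only [wsum, Finset.sum_mul, mul_assoc]

theorem wsum_const_mul (S : Finset ℕ) (f : List ℕ → K) (c : K) :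
    wsum S (fun w => c * f w) = c * wsum S f := by
  simp only [wsum, Finset.mul_sum, mul_left_comm]

theorem wsum_take_mul_drop {f g : List ℕ → K} (hf : OrderInvariant f) (hg : OrderInvariant g)
    {n k : ℕ} (hk : k ≤ n) :
    wsum (range n) (fun w => f (w.take k) * g (w.drop k)) =
      qBinom n k * (wsum (range k) f * wsum (range (n - k)) g) := by
  rw [wsum_split (range n) k (by simpa using hk) (fun x y => f x * g y)]
  have := sum_cross (range n) k
  rw [card_range] at this
  rw [← this, Finset.sum_mul]
  refine Finset.sum_congr rfl fun C hC => ?_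
  obtain ⟨hCS, hc⟩ := mem_powersetCard.1 hC
  simp only [wsum_const_mul, wsum_mul_const]
  rw [wsum_eq_range C hf, wsum_eq_range _ hg, hc, Finset.card_sdiff_of_subset hCS, hc, card_range]

/-! ### Descents, matches and the two weights on words. -/

/-- The number of descents of a word. -/
def desL (w : List ℕ) : ℕ :=
  ∑ i ∈ range (w.length - 1), if w.getD (i + 1) 0 < w.getD i 0 then 1 else 0

/-- The first `p` letters of `w` are in the same relative order as those of `τ`. -/
def MatchHead {p : ℕ} (τ : Equiv.Perm (Fin p)) (w : List ℕ) : Prop :=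
  p ≤ w.length ∧ ∀ a b : Fin p, w.getD a 0 < w.getD b 0 ↔ τ a < τ b

instance {p : ℕ} (τ : Equiv.Perm (Fin p)) (w : List ℕ) : Decidable (MatchHead τ w) := by
  unfold MatchHead; infer_instance

/-- Some consecutive letters of `w` are in the same relative order as those of `τ`. -/
def HasMatch {p : ℕ} (τ : Equiv.Perm (Fin p)) (w : List ℕ) : Prop :=
  ∃ i, MatchHead τ (w.drop i)

noncomputable instance {p : ℕ} (τ : Equiv.Perm (Fin p)) (w : List ℕ) :
    Decidable (HasMatch τ w) := Classical.dec _

/-- No two occurrences of `τ` in a word with distinct letters share more than one letter. -/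
def NonOverlapping {p : ℕ} (τ : Equiv.Perm (Fin p)) : Prop :=
  ∀ (w : List ℕ) (d : ℕ), w.Nodup → 1 ≤ d → MatchHead τ w → MatchHead τ (w.drop d) → p - 1 ≤ d

/-- The contribution of a word to `INM`. -/
noncomputable def nmWeight {p : ℕ} (τ : Equiv.Perm (Fin p)) (w : List ℕ) : K :=
  if w = [] then 1 else if HasMatch τ w then 0 else z ^ (desL w + 1)

/-- The contribution of a word to `IU`: the signed sum over all ways to cover the word by chains of
ascents of length two and occurrences of `τ`, in which consecutive links share one letter. -/
noncomputable def chainWeight {p : ℕ} (τ : Equiv.Perm (Fin p)) : List ℕ → K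
  | [] => 1
  | [_] => -z
  | c :: d :: w =>
    (if c < d then (1 - z) * chainWeight τ (d :: w) else 0) -
      if MatchHead τ (c :: d :: w) then z ^ des τ * chainWeight τ ((d :: w).drop (p - 2)) else 0
termination_by w => w.length
decreasing_by all_goals simp

-- With `m = p - 2` this follows the two recursive calls of `chainWeight`.
@[elab_as_elim]
theorem list_drop_induction {α : Type*} (m : ℕ) {P : List α → Prop} (nil : P [])
    (singleton : ∀ c, P [c])
    (cons_cons : ∀ c d w, P (d :: w) → P ((d :: w).drop m) → P (c :: d :: w)) (w : List α) :
    P w := by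
  induction hn : w.length using Nat.strong_induction_on generalizing w with
  | _ n ih =>
    match w, hn with
    | [], _ => exact nil
    | [c], _ => exact singleton c
    | c :: d :: w, hn =>
      simp only [List.length_cons] at hn
      have hd : (d :: w).length = w.length + 1 := rfl
      exact cons_cons c d w (ih _ (by omega) _ rfl)
        (ih _ (by rw [List.length_drop]; omega) _ rfl)

theorem desL_singleton (c : ℕ) : desL [c] = 0 := by simp [desL]

theorem desL_cons_cons (c d : ℕ) (w : List ℕ) :
    desL (c :: d :: w) = (if d < c then 1 else 0) + desL (d :: w) := by
  rw [desL, List.length_cons, Nat.add_sub_cancel, List.length_cons, Finset.sum_range_succ',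
    add_comm]
  simp only [desL, List.length_cons, Nat.add_sub_cancel, List.getD_cons_succ, List.getD_cons_zero,
    zero_add]

/-- The two pieces share the letter at index `k`, so each adjacent pair lies in exactly one of them.
-/
theorem desL_eq_add_drop (w : List ℕ) (k : ℕ) (hk : k + 1 ≤ w.length) :
    desL w = desL (w.take (k + 1)) + desL (w.drop k) := by
  obtain ⟨m, hm⟩ : ∃ m, w.length - 1 = k + m := ⟨w.length - 1 - k, by omega⟩
  rw [desL, hm, Finset.sum_range_add, desL, desL, List.length_take, List.length_drop,
    min_eq_left hk, show w.length - k - 1 = m by omega, Nat.add_sub_cancel]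
  congr 1
  · refine Finset.sum_congr rfl fun i hi => ?_
    have hi' := Finset.mem_range.1 hi
    simp [List.getD_eq_getElem?_getD, hi', Nat.lt_succ_of_lt hi']
  · refine Finset.sum_congr rfl fun i hi => ?_
    simp [List.getD_eq_getElem?_getD, add_assoc]

theorem getD_map_of_lt (w : List ℕ) (φ : ℕ → ℕ) {i : ℕ} (hi : i < w.length) :
    (w.map φ).getD i 0 = φ (w.getD i 0) := by
  simp [List.getD_eq_getElem?_getD, hi]

theorem getD_mem_of_lt {w : List ℕ} {i : ℕ} (hi : i < w.length) : w.getD i 0 ∈ w := by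
  simp [List.getD_eq_getElem?_getD, hi]

theorem getD_map_lt_iff {w : List ℕ} {φ : ℕ → ℕ} (h : StrictMonoOn φ {x | x ∈ w}) {i j : ℕ}
    (hi : i < w.length) (hj : j < w.length) :
    (w.map φ).getD i 0 < (w.map φ).getD j 0 ↔ w.getD i 0 < w.getD j 0 := by
  rw [getD_map_of_lt _ _ hi, getD_map_of_lt _ _ hj]
  exact h.lt_iff_lt (getD_mem_of_lt hi) (getD_mem_of_lt hj)

theorem orderInvariant_desL : OrderInvariant desL := by
  intro w φ h
  rw [desL, desL, List.length_map]
  refine Finset.sum_congr rfl fun i hi => ?_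
  have := Finset.mem_range.1 hi
  simp only [getD_map_lt_iff h (show i + 1 < w.length by omega) (show i < w.length by omega)]

section
variable {p : ℕ} (τ : Equiv.Perm (Fin p))

theorem orderInvariant_matchHead : OrderInvariant (MatchHead τ) := by
  intro w φ h
  unfold MatchHead
  rw [List.length_map]
  refine propext (and_congr_right fun hp => forall_congr' fun a => forall_congr' fun b => ?_)
  rw [getD_map_lt_iff h (a.2.trans_le hp) (b.2.trans_le hp)]

theorem strictMonoOn_drop {w : List ℕ} {φ : ℕ → ℕ} (h : StrictMonoOn φ {x | x ∈ w}) (i : ℕ) :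
    StrictMonoOn φ {x | x ∈ w.drop i} :=
  h.mono fun _ hx => List.mem_of_mem_drop hx

theorem orderInvariant_hasMatch : OrderInvariant (HasMatch τ) := by
  intro w φ h
  refine propext (exists_congr fun i => ?_)
  rw [← List.map_drop, orderInvariant_matchHead τ _ φ (strictMonoOn_drop h i)]

theorem orderInvariant_nmWeight : OrderInvariant (nmWeight τ) := by
  intro w φ h
  have h1 : HasMatch τ (w.map φ) ↔ HasMatch τ w := iff_of_eq (orderInvariant_hasMatch τ w φ h)
  simp only [nmWeight, List.map_eq_nil_iff, h1, orderInvariant_desL w φ h]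

theorem orderInvariant_chainWeight : OrderInvariant (chainWeight τ) := by
  intro w φ
  induction w using list_drop_induction (p - 2) with
  | nil => simp
  | singleton c => simp [chainWeight]
  | cons_cons c d w ih1 ih2 =>
    intro h
    have hd : StrictMonoOn φ {x | x ∈ d :: w} := strictMonoOn_drop h 1
    have h1 := ih1 hd
    have h2 := ih2 (strictMonoOn_drop hd _)
    have h3 := iff_of_eq (orderInvariant_matchHead τ _ φ h)
    rw [List.map_drop] at h2
    simp only [List.map_cons] at h1 h2 h3 ⊢
    rw [chainWeight, chainWeight, h1, h2]
    simp only [h3, h.lt_iff_lt (a := c) (b := d) (by simp) (by simp)]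

/-! ### Cancellation of the two weights on a single word. -/

variable {τ}

theorem matchHead_take_iff {w : List ℕ} {k : ℕ} :
    MatchHead τ (w.take k) ↔ p ≤ k ∧ MatchHead τ w := by
  unfold MatchHead
  rw [List.length_take, le_min_iff, and_assoc]
  refine and_congr_right fun hk => and_congr_right fun _ => ?_
  refine forall_congr' fun a => forall_congr' fun b => ?_
  simp [List.getD_eq_getElem?_getD, a.2.trans_le hk, b.2.trans_le hk]

/-- A word starting with `τ` starts with its smallest letter among the first `p`. -/
theorem MatchHead.first_lt {w : List ℕ} (h : MatchHead τ w) (hp : 0 < p) (h0 : τ ⟨0, hp⟩ = ⟨0, hp⟩)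
    {i : ℕ} (hi : i < p) (hi0 : i ≠ 0) : w.getD 0 0 < w.getD i 0 := by
  have := (h.2 ⟨0, hp⟩ ⟨i, hi⟩).2 ?_
  · exact this
  · rw [h0, Fin.lt_def]
    have : τ ⟨i, hi⟩ ≠ ⟨0, hp⟩ := by
      rw [← h0]
      exact fun h => hi0 (by simpa using τ.injective h)
    exact Nat.pos_of_ne_zero fun h => this (Fin.ext h)

theorem des_eq_sum (τ : Equiv.Perm (Fin p)) {w : List ℕ} (h : MatchHead τ w) :
    des τ = desL (w.take p) := by
  rw [des, desL, List.length_take, min_eq_left h.1, Finset.card_filter]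
  rcases Nat.eq_zero_or_pos p with rfl | hp
  · simp
  have key : ∀ i : Fin p, (if ∃ hi : (i : ℕ) + 1 < p, τ ⟨(i : ℕ) + 1, hi⟩ < τ i then 1 else 0) =
      (fun i : ℕ => if i + 1 < p ∧ w.getD (i + 1) 0 < w.getD i 0 then 1 else 0) (i : ℕ) := by
    intro i
    refine if_congr ?_ rfl rfl
    constructor
    · rintro ⟨hi, h1⟩
      exact ⟨hi, (h.2 ⟨i + 1, hi⟩ i).2 h1⟩
    · rintro ⟨hi, h1⟩
      exact ⟨hi, (h.2 ⟨i + 1, hi⟩ i).1 h1⟩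
  -- The position `p - 1` has no successor, so its summand is zero and can be split off.
  rw [Finset.sum_congr rfl fun i _ => key i,
    Fin.sum_univ_eq_sum_range
      (fun i : ℕ => if i + 1 < p ∧ w.getD (i + 1) 0 < w.getD i 0 then 1 else 0),
    show range p = range (p - 1 + 1) by rw [Nat.sub_add_cancel hp], Finset.sum_range_succ,
    if_neg (by omega), add_zero]
  refine Finset.sum_congr rfl fun i hi => ?_
  have hi' := Finset.mem_range.1 hi
  have h1 : i + 1 < p := by omega
  have h2 : i < p := by omega
  simp [List.getD_eq_getElem?_getD, h1, h2]

/-- If `w` starts with `τ`, then removing the first letter or the first `p - 1` letters changes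
`nmWeight` by the factor `z ^ des τ`. -/
theorem nmWeight_tail_of_matchHead (hp : 3 ≤ p) (h0 : τ ⟨0, by omega⟩ = ⟨0, by omega⟩)
    (hτ : NonOverlapping τ) {c d : ℕ} {w : List ℕ} (hw : (c :: d :: w).Nodup)
    (h : MatchHead τ (c :: d :: w)) :
    nmWeight τ (d :: w) = z ^ des τ * nmWeight τ ((d :: w).drop (p - 2)) := by
  have hl : p ≤ w.length + 2 := h.1
  have hne : (d :: w).drop (p - 2) ≠ [] := by
    rw [Ne, List.drop_eq_nil_iff]
    simp
    omega
  have hdrop : (c :: d :: w).drop (p - 1) = (d :: w).drop (p - 2) := by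
    rw [show p - 1 = p - 2 + 1 by omega, List.drop_succ_cons]
  have hm : HasMatch τ (d :: w) ↔ HasMatch τ ((d :: w).drop (p - 2)) := by
    constructor
    · rintro ⟨i, hi⟩
      -- In the full word this second match starts at `i + 1`, hence at or beyond the last letter of
      -- the first one.
      have := hτ _ (i + 1) hw (by omega) h (by simpa using hi)
      refine ⟨i - (p - 2), ?_⟩
      rw [List.drop_drop]
      rwa [show p - 2 + (i - (p - 2)) = i by omega]
    · rintro ⟨i, hi⟩
      rw [List.drop_drop] at hi
      exact ⟨_, hi⟩
  have hcd : c < d := by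
    simpa using h.first_lt (by omega) h0 (i := 1) (by omega) (by omega)
  have hdes : desL (d :: w) = des τ + desL ((d :: w).drop (p - 2)) := by
    have h1 := desL_cons_cons c d w
    rw [if_neg (by omega), zero_add] at h1
    rw [← h1, desL_eq_add_drop _ (p - 1) (by simp; omega), hdrop, des_eq_sum τ h,
      show p - 1 + 1 = p by omega]
  unfold nmWeight
  rw [if_neg (by simp), if_neg hne, if_congr hm rfl rfl, hdes]
  split_ifs
  · simp
  · ring

theorem hasMatch_cons {c : ℕ} {w : List ℕ} :
    HasMatch τ (c :: w) ↔ MatchHead τ (c :: w) ∨ HasMatch τ w := by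
  constructor
  · rintro ⟨i, hi⟩
    cases i with
    | zero => exact Or.inl hi
    | succ i => exact Or.inr ⟨i, hi⟩
  · rintro (h | ⟨i, hi⟩)
    · exact ⟨0, h⟩
    · exact ⟨i + 1, hi⟩

/-- The terms of the convolution of `chainWeight` and `nmWeight` with a non-empty first factor. -/
theorem sum_chainWeight_succ (hp : 3 ≤ p) (h0 : τ ⟨0, by omega⟩ = ⟨0, by omega⟩)
    (hτ : NonOverlapping τ) (w : List ℕ) (hw : w.Nodup) (hne : w ≠ []) :
    ∑ k ∈ range w.length, chainWeight τ (w.take (k + 1)) * nmWeight τ (w.drop (k + 1)) =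
      -nmWeight τ w := by
  induction w using list_drop_induction (p - 2) with
  | nil => exact absurd rfl hne
  | singleton c =>
    have : ¬ HasMatch τ [c] := by
      rintro ⟨i, hi, -⟩
      simp at hi
      omega
    simp [chainWeight, nmWeight, this, desL_singleton]
  | cons_cons c d w ih1 ih2 =>
    have hd : (d :: w).Nodup := hw.of_cons
    have ih1 := ih1 hd (by simp)
    have hne' : MatchHead τ (c :: d :: w) → (d :: w).drop (p - 2) ≠ [] := by
      intro h
      have hl : p ≤ w.length + 2 := h.1
      rw [Ne, List.drop_eq_nil_iff]
      simp
      omega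
    have ih2 := fun h => ih2 (hd.sublist (List.drop_sublist _ _)) (hne' h)
    -- The prefix has `k + 2` letters, so its chain can start with a `τ` link only if `p ≤ k + 2`.
    have hstep : ∀ k ∈ range (d :: w).length,
        chainWeight τ ((c :: d :: w).take (k + 1 + 1)) *
          nmWeight τ ((c :: d :: w).drop (k + 1 + 1)) =
        (if c < d then (1 - z) else 0) *
          (chainWeight τ ((d :: w).take (k + 1)) * nmWeight τ ((d :: w).drop (k + 1))) -
        if p ≤ k + 2 ∧ MatchHead τ (c :: d :: w) then
          z ^ des τ * (chainWeight τ (((d :: w).drop (p - 2)).take (k + 1 - (p - 2))) *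
            nmWeight τ ((d :: w).drop (k + 1))) else 0 := by
      intro k _
      have h1 := matchHead_take_iff (τ := τ) (w := c :: d :: w) (k := k + 1 + 1)
      simp only [List.take_succ_cons, List.drop_succ_cons] at h1 ⊢
      rw [chainWeight]
      simp only [h1]
      have h2 : (d :: w.take k).drop (p - 2) =
          ((d :: w).drop (p - 2)).take (k + 1 - (p - 2)) := by
        rw [← List.drop_take, List.take_succ_cons]
      rw [h2]
      split_ifs <;> ring
    rw [List.length_cons, Finset.sum_range_succ', Finset.sum_congr rfl hstep,
      Finset.sum_sub_distrib, ← Finset.mul_sum, ih1]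
    -- Write `N` for the weight of `d :: w`. The one-letter prefix gives `-z * N` and an initial
    -- ascent gives `-(1 - z) * N`: together `-N` if `c < d`, and `-z * N` otherwise. At a match,
    -- the `τ` links contribute exactly `N` and cancel this.
    rw [show chainWeight τ ((c :: d :: w).take (0 + 1)) = -z by simp [chainWeight],
      show (c :: d :: w).drop (0 + 1) = d :: w from rfl]
    by_cases hm : MatchHead τ (c :: d :: w)
    · have hl : p ≤ w.length + 2 := hm.1
      have hcd : c < d := by
        simpa using hm.first_lt (by omega) h0 (i := 1) (by omega) (by omega)
      have hs : ∑ k ∈ range (d :: w).length,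
          (if p ≤ k + 2 ∧ MatchHead τ (c :: d :: w) then
          z ^ des τ * (chainWeight τ (((d :: w).drop (p - 2)).take (k + 1 - (p - 2))) *
            nmWeight τ ((d :: w).drop (k + 1))) else 0) =
          z ^ des τ * ∑ k ∈ range ((d :: w).drop (p - 2)).length,
            chainWeight τ (((d :: w).drop (p - 2)).take (k + 1)) *
              nmWeight τ (((d :: w).drop (p - 2)).drop (k + 1)) := by
        rw [List.length_drop, show (d :: w).length = (p - 2) + ((d :: w).length - (p - 2)) by
          simp; omega, Finset.sum_range_add, Finset.sum_eq_zero, zero_add, Finset.mul_sum]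
        · refine Finset.sum_congr (by simp) fun k _ => ?_
          rw [if_pos ⟨by omega, hm⟩, List.drop_drop,
            show p - 2 + k + 1 - (p - 2) = k + 1 by omega, add_assoc]
        · intro k hk
          have := Finset.mem_range.1 hk
          rw [if_neg (by omega)]
      have ha : nmWeight τ (c :: d :: w) = 0 := by
        rw [nmWeight, if_neg (by simp), if_pos ⟨0, hm⟩]
      rw [hs, ih2 hm, ha, if_pos hcd, nmWeight_tail_of_matchHead hp h0 hτ hw hm]
      ring
    · have ha : nmWeight τ (c :: d :: w) = (if c < d then 1 else z) * nmWeight τ (d :: w) := by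
        have hcd : c ≠ d := by
          rintro rfl
          simp at hw
        rw [nmWeight, nmWeight, if_neg (List.cons_ne_nil _ _), if_neg (List.cons_ne_nil _ _),
          desL_cons_cons]
        have hm' : HasMatch τ (c :: d :: w) ↔ HasMatch τ (d :: w) := by
          simp [hasMatch_cons (c := c), hm]
        rw [if_congr hm' rfl rfl]
        split_ifs <;> first | omega | ring
      simp only [hm, and_false, if_false, Finset.sum_const_zero, ha]
      split_ifs <;> ring

theorem sum_chainWeight_mul_nmWeight (hp : 3 ≤ p) (h0 : τ ⟨0, by omega⟩ = ⟨0, by omega⟩)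
    (hτ : NonOverlapping τ) (w : List ℕ) (hw : w.Nodup) (hne : w ≠ []) :
    ∑ k ∈ range (w.length + 1), chainWeight τ (w.take k) * nmWeight τ (w.drop k) = 0 := by
  rw [Finset.sum_range_succ', sum_chainWeight_succ hp h0 hτ w hw hne]
  simp [chainWeight]

/-- Only words that start with their smallest letter contribute to `IU`. -/
theorem head_lt_of_chainWeight_ne_zero (hp : 3 ≤ p) (h0 : τ ⟨0, by omega⟩ = ⟨0, by omega⟩)
    (w : List ℕ) : chainWeight τ w ≠ 0 → ∀ i, i + 1 < w.length → w.getD 0 0 < w.getD (i + 1) 0 := by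
  induction w using list_drop_induction (p - 2) with
  | nil => simp
  | singleton c => simp
  | cons_cons c d w ih1 ih2 =>
    intro h i hi
    by_cases hA : c < d ∧ chainWeight τ (d :: w) ≠ 0
    · cases i with
      | zero => simpa using hA.1
      | succ i =>
        have := ih1 hA.2 i (by simpa using hi)
        have h1 := hA.1
        simp at this ⊢
        omega
    · by_cases hB : MatchHead τ (c :: d :: w) ∧ chainWeight τ ((d :: w).drop (p - 2)) ≠ 0
      · by_cases hip : i + 1 < p
        · exact hB.1.first_lt (by omega) h0 hip (by omega)
        -- Beyond the first link, compare through its last letter: it exceeds the first letter of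
        -- the word and, by induction, lies below all later ones.
        · have h1 := hB.1.first_lt (by omega) h0 (i := p - 1) (by omega) (by omega)
          obtain ⟨m, rfl⟩ : ∃ m, i = (p - 2) + (m + 1) := ⟨i - (p - 2) - 1, by omega⟩
          have h2 := ih2 hB.2 m (by simp at hi ⊢; omega)
          refine h1.trans ?_
          rw [show p - 1 = p - 2 + 1 by omega]
          simpa [List.getD_eq_getElem?_getD] using h2
      · refine absurd ?_ h
        rw [chainWeight]
        rw [not_and, not_not] at hA hB
        split_ifs with h1 h2 h2 <;> simp_all

end

/-! ### Translation between permutations and words. -/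

/-- The word of a permutation. -/
def toWord {n : ℕ} (σ : Equiv.Perm (Fin n)) : List ℕ := List.ofFn fun i => (σ i : ℕ)

@[simp] theorem length_toWord {n : ℕ} (σ : Equiv.Perm (Fin n)) : (toWord σ).length = n := by
  simp [toWord]

theorem getD_toWord {n : ℕ} (σ : Equiv.Perm (Fin n)) (i : Fin n) :
    (toWord σ).getD i 0 = (σ i : ℕ) := by
  simp [toWord, List.getD_eq_getElem?_getD]

theorem toWord_mem_arr {n : ℕ} (σ : Equiv.Perm (Fin n)) : toWord σ ∈ arr (range n) := by
  refine mem_arr.2 ⟨List.nodup_ofFn.2 (Fin.val_injective.comp σ.injective), ?_⟩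
  ext x
  simp only [toWord, List.mem_toFinset, List.mem_ofFn, Finset.mem_range]
  constructor
  · rintro ⟨i, rfl⟩
    exact (σ i).2
  · intro hx
    exact ⟨σ.symm ⟨x, hx⟩, by simp⟩

theorem toWord_injective {n : ℕ} : Function.Injective (toWord (n := n)) := by
  intro σ ρ h
  refine Equiv.ext fun i => Fin.ext ?_
  rw [← getD_toWord, h, getD_toWord]

theorem exists_toWord_eq {n : ℕ} {w : List ℕ} (hw : w ∈ arr (range n)) :
    ∃ σ : Equiv.Perm (Fin n), toWord σ = w := by
  have hl : w.length = n := by simpa using length_of_mem_arr hw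
  have hlt : ∀ i : Fin n, w.getD i 0 < n := fun i => by
    rw [← Finset.mem_range, ← mem_iff_of_mem_arr hw]
    exact getD_mem_of_lt (by omega)
  have hinj : Function.Injective fun i : Fin n => (⟨w.getD i 0, hlt i⟩ : Fin n) := by
    intro i j h
    have h1 : w.getD i 0 = w.getD j 0 := by simpa using h
    have hi : (i : ℕ) < w.length := by omega
    have hj : (j : ℕ) < w.length := by omega
    rw [List.getD_eq_getElem _ _ hi, List.getD_eq_getElem _ _ hj,
      (mem_arr.1 hw).1.getElem_inj_iff] at h1
    exact Fin.ext h1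
  refine ⟨Equiv.ofBijective _ (Finite.injective_iff_bijective.1 hinj), ?_⟩
  refine List.ext_getElem (by simp [hl]) fun i h1 h2 => ?_
  simp [toWord, h2]

theorem sum_perm_eq_sum_arr {M : Type*} [AddCommMonoid M] (n : ℕ) (F : List ℕ → M) :
    ∑ σ : Equiv.Perm (Fin n), F (toWord σ) = ∑ w ∈ arr (range n), F w := by
  refine Finset.sum_bij (fun σ _ => toWord σ) (fun σ _ => toWord_mem_arr σ)
    (fun σ _ ρ _ h => toWord_injective h) (fun w hw => ?_) (fun _ _ => rfl)
  obtain ⟨σ, hσ⟩ := exists_toWord_eq hw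
  exact ⟨σ, Finset.mem_univ _, hσ⟩

theorem card_inversions_eq_invL {n : ℕ} (f : Fin n → ℕ) :
    #(univ.filter fun x : Fin n × Fin n => x.1 < x.2 ∧ f x.2 < f x.1) = invL (List.ofFn f) := by
  rw [Finset.card_filter, Fintype.sum_prod_type]
  induction n with
  | zero => simp [invL]
  | succ n ih =>
    rw [List.ofFn_succ, invL, ← ih (fun i => f i.succ), Fin.sum_univ_succ]
    congr 1
    · rw [Fin.sum_univ_succ]
      simp only [lt_self_iff_false, false_and, if_false, zero_add, Fin.succ_pos, true_and]
      rw [List.countP_eq_length_filter, ← Finset.card_filter, List.ofFn_eq_map, List.filter_map,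
        List.length_map, ← List.toFinset_card_of_nodup ((List.nodup_finRange n).filter _)]
      congr 1
      ext i
      simp
    · refine Finset.sum_congr rfl fun i _ => ?_
      rw [Fin.sum_univ_succ]
      simp

theorem inv_eq_invL {n : ℕ} (σ : Equiv.Perm (Fin n)) : inv σ = invL (toWord σ) := by
  rw [toWord, ← card_inversions_eq_invL, inv]
  simp only [Fin.lt_def]

theorem matchHead_toWord {n : ℕ} (σ : Equiv.Perm (Fin n)) : MatchHead σ (toWord σ) :=
  ⟨by simp, fun a b => by rw [getD_toWord, getD_toWord, Fin.lt_def]⟩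

theorem des_eq_desL {n : ℕ} (σ : Equiv.Perm (Fin n)) : des σ = desL (toWord σ) := by
  rw [des_eq_sum σ (matchHead_toWord σ), List.take_of_length_le (by simp)]

theorem red_lt_red_iff {p : ℕ} (w : Fin p → ℕ) (a b : Fin p) : red w a < red w b ↔ w a < w b := by
  constructor
  · intro h
    by_contra hab
    refine absurd h (not_lt.2 (Finset.card_le_card fun c hc => ?_))
    rw [Finset.mem_filter] at hc ⊢
    exact ⟨hc.1, by omega⟩
  · intro h
    refine Finset.card_lt_card ?_
    rw [Finset.ssubset_iff_of_subset]
    · exact ⟨a, by simpa using h, by simp⟩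
    · intro c hc
      rw [Finset.mem_filter] at hc ⊢
      exact ⟨hc.1, by omega⟩

/-- Exactly `τ a` values of `τ` lie below `τ a`, so counting smaller letters recovers `τ` from the
relative order. -/
theorem red_eq_iff {p : ℕ} (w : Fin p → ℕ) (τ : Equiv.Perm (Fin p)) :
    (∀ a, red w a = (τ a : ℕ)) ↔ ∀ a b, w a < w b ↔ τ a < τ b := by
  constructor
  · intro h a b
    rw [← red_lt_red_iff w, h, h, Fin.lt_def]
  · intro h a
    simp only [red, h]
    rw [← Finset.card_map τ.toEmbedding]
    convert Fin.card_Iio (τ a) using 2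
    ext x
    simp only [Finset.mem_map, Finset.mem_filter, Finset.mem_univ, true_and, Finset.mem_Iio]
    constructor
    · rintro ⟨b, hb, rfl⟩
      exact hb
    · intro hx
      exact ⟨τ.symm x, by simpa using hx, by simp⟩

theorem isMatchAt_iff {p n : ℕ} (hp : 0 < p) (τ : Equiv.Perm (Fin p)) (σ : Equiv.Perm (Fin n))
    (i : ℕ) : IsMatchAt τ σ i ↔ MatchHead τ ((toWord σ).drop i) := by
  have hg : ∀ h : i + p ≤ n, ∀ b : Fin p,
      ((toWord σ).drop i).getD b 0 = (σ ⟨i + (b : ℕ), by omega⟩ : ℕ) := by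
    intro h b
    rw [← getD_toWord]
    simp [List.getD_eq_getElem?_getD]
  constructor
  · rintro ⟨h, h1⟩
    refine ⟨by simp; omega, ?_⟩
    rw [red_eq_iff] at h1
    intro a b
    rw [hg h, hg h]
    exact h1 a b
  · rintro ⟨h, h1⟩
    have h' : i + p ≤ n := by simp at h; omega
    refine ⟨h', ?_⟩
    rw [red_eq_iff]
    intro a b
    rw [← hg h', ← hg h']
    exact h1 a b

/-- Length zero is excluded because there the weight of the empty word is `1`, whereas `INMcoeff`
gives `z`. -/
theorem INMcoeff_eq_wsum {p : ℕ} (hp : 0 < p) (τ : Equiv.Perm (Fin p)) {n : ℕ} (hn : 1 ≤ n) :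
    INMcoeff τ n = wsum (range n) (nmWeight τ) := by
  rw [wsum, ← sum_perm_eq_sum_arr n fun w => q ^ invL w * nmWeight τ w, INMcoeff, NM,
    Finset.sum_filter]
  refine Finset.sum_congr rfl fun σ _ => ?_
  have hne : toWord σ ≠ [] := by
    intro h
    have := length_toWord σ
    rw [h] at this
    simp at this
    omega
  have hm : (∀ i ≤ n, ¬ IsMatchAt τ σ i) ↔ ¬ HasMatch τ (toWord σ) := by
    rw [HasMatch, not_exists]
    constructor
    · intro h i hi
      rw [← isMatchAt_iff hp] at hi
      exact h i (by obtain ⟨h, -⟩ := hi; omega) hi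
    · intro h i _ hi
      exact h i ((isMatchAt_iff hp τ σ i).1 hi)
  rw [if_congr hm rfl rfl, nmWeight, if_neg hne, des_eq_desL, inv_eq_invL]
  split_ifs <;> first | contradiction | ring

/-- Two matches at distance `d < p - 1` would, after truncation and standardization, give a
permutation of length `d + p < 2 * p - 1`. Strong induction on `d` excludes a match strictly between
them, so it would have exactly two matches, against minimality. -/
theorem IsMinimalOverlapping.nonOverlapping {p : ℕ} {τ : Equiv.Perm (Fin p)}
    (hτ : IsMinimalOverlapping τ) : NonOverlapping τ := by
  intro w d
  induction d using Nat.strong_induction_on generalizing w with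
  | _ d ih =>
    intro hw hd h1 h2
    have hp := hτ.1
    by_contra hlt
    have hl : d + p ≤ w.length := by
      have := h2.1
      rw [List.length_drop] at this
      omega
    set v := w.take (d + p) with hv
    have hvn : v.Nodup := hw.sublist (List.take_sublist _ _)
    have hva : v ∈ arr v.toFinset := mem_arr.2 ⟨hvn, rfl⟩
    have hvl : v.length = d + p := by rw [hv, List.length_take]; omega
    have hφ : StrictMonoOn (rank v.toFinset) {x | x ∈ v} :=
      (strictMonoOn_rank v.toFinset).mono fun x hx => by simpa using hx
    have hmem := map_mem_arr_image (strictMonoOn_rank v.toFinset).injOn hva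
    rw [image_rank, ← length_of_mem_arr hva, hvl] at hmem
    obtain ⟨σ, hσ⟩ := exists_toWord_eq hmem
    have hmatch : ∀ i, IsMatchAt τ σ i ↔ i + p ≤ d + p ∧ MatchHead τ (w.drop i) := by
      intro i
      rw [isMatchAt_iff (by omega), hσ, ← List.map_drop,
        orderInvariant_matchHead τ _ _ (strictMonoOn_drop hφ i), hv, List.drop_take,
        matchHead_take_iff]
      refine and_congr_left fun _ => ?_
      omega
    have hmch : mch τ σ = 2 := by
      rw [mch, ← Finset.card_pair (show (0 : ℕ) ≠ d by omega)]
      congr 1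
      ext i
      simp only [Finset.mem_filter, Finset.mem_range, hmatch, Finset.mem_insert,
        Finset.mem_singleton]
      constructor
      · rintro ⟨-, hi, hi'⟩
        by_contra hne
        rw [not_or] at hne
        have := ih i (by omega) w hw (by omega) h1 hi'
        omega
      · rintro (rfl | rfl)
        · exact ⟨by omega, by omega, h1⟩
        · exact ⟨by omega, by omega, h2⟩
    have := hτ.2.2 ⟨σ, hmch⟩
    omega

/-! ### The recursion for the chain sums, by the first link. -/

/-- Exactly one arrangement of a set with `p` elements is in the same relative order as `τ`. -/
theorem wsum_matchHead {p : ℕ} (τ : Equiv.Perm (Fin p)) {C : Finset ℕ} (hC : #C = p) :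
    wsum C (fun x => if MatchHead τ x then 1 else 0) = q ^ inv τ := by
  have hinv : OrderInvariant fun x => if MatchHead τ x then (1 : K) else 0 := fun w φ h =>
    if_congr (iff_of_eq (orderInvariant_matchHead τ w φ h)) rfl rfl
  rw [wsum_eq_range C hinv, hC, wsum,
    ← sum_perm_eq_sum_arr p fun w => q ^ invL w * if MatchHead τ w then (1 : K) else 0,
    Finset.sum_eq_single τ]
  · rw [if_pos (matchHead_toWord τ), mul_one, inv_eq_invL]
  · intro σ _ hσ
    rw [if_neg, mul_zero]
    rintro ⟨-, h⟩
    refine hσ (Equiv.ext fun a => Fin.ext ?_)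
    have h1 := (red_eq_iff (fun a => (σ a : ℕ)) τ).2 fun a b => by
      rw [← h a b, getD_toWord, getD_toWord]
    have h2 := (red_eq_iff (fun a => (σ a : ℕ)) σ).2 fun a b => by rw [Fin.lt_def]
    rw [← h1, h2]
  · simp

theorem wsum_congr {S : Finset ℕ} {f g : List ℕ → K} (h : ∀ w ∈ arr S, f w = g w) :
    wsum S f = wsum S g :=
  Finset.sum_congr rfl fun w hw => by rw [h w hw]

theorem wsum_eq_zero {S : Finset ℕ} {f : List ℕ → K} (h : ∀ w ∈ arr S, f w = 0) :
    wsum S f = 0 :=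
  Finset.sum_eq_zero fun w hw => by rw [h w hw, mul_zero]

section
variable {p : ℕ} {τ : Equiv.Perm (Fin p)}

theorem lt_of_chainWeight_cons_ne_zero (hp : 3 ≤ p) (h0 : τ ⟨0, by omega⟩ = ⟨0, by omega⟩)
    {c : ℕ} {y : List ℕ} (h : chainWeight τ (c :: y) ≠ 0) {x : ℕ} (hx : x ∈ y) : c < x := by
  obtain ⟨i, hi, rfl⟩ := List.getElem_of_mem hx
  simpa [hi] using head_lt_of_chainWeight_ne_zero hp h0 _ h i (by simpa using hi)

theorem wsum_chainWeight_cons_eq_zero (hp : 3 ≤ p) (h0 : τ ⟨0, by omega⟩ = ⟨0, by omega⟩)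
    {c x : ℕ} {D : Finset ℕ} (hx : x ∈ D) (hxc : x ≤ c) :
    wsum D (fun y => chainWeight τ (c :: y)) = 0 := by
  refine wsum_eq_zero fun y hy => ?_
  by_contra h
  have := lt_of_chainWeight_cons_ne_zero hp h0 h ((mem_iff_of_mem_arr hy x).2 hx)
  omega

/-- Among the arrangements of `insert c D`, only those starting with the minimum `c` have nonzero
chain weight, so fixing the first letter loses nothing. -/
theorem wsum_chainWeight_cons (hp : 3 ≤ p) (h0 : τ ⟨0, by omega⟩ = ⟨0, by omega⟩)
    {c : ℕ} {D : Finset ℕ} (hD : ∀ x ∈ D, c < x) :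
    wsum D (fun y => chainWeight τ (c :: y)) = wsum (range (#D + 1)) (chainWeight τ) := by
  have hc : c ∉ D := fun h => lt_irrefl c (hD c h)
  rw [← card_insert_of_notMem hc, ← wsum_eq_range _ (orderInvariant_chainWeight τ),
    wsum_cons (insert_nonempty _ _), Finset.sum_eq_single c]
  · have : rank (insert c D) c = 0 := by
      rw [rank, card_eq_zero, Finset.filter_eq_empty_iff]
      intro x hx
      rcases Finset.mem_insert.1 hx with rfl | hx
      · exact lt_irrefl x
      · exact (hD x hx).le.not_gt
    rw [this, erase_insert hc, pow_zero, one_mul]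
  · intro x hx hxc
    have hx' := (Finset.mem_insert.1 hx).resolve_left hxc
    rw [wsum_chainWeight_cons_eq_zero hp h0 (x := c) (by simp [Ne.symm hxc]) (hD x hx').le,
      mul_zero]
  · simp

theorem chainWeight_of_two_le_length (hp : 3 ≤ p) {w : List ℕ} (hw : 2 ≤ w.length) :
    chainWeight τ w =
      (if w.getD 0 0 < w.getD 1 0 then (1 - z) * chainWeight τ (w.drop 1) else 0) -
      if MatchHead τ w then z ^ des τ * chainWeight τ (w.drop (p - 1)) else 0 := by
  match w, hw with
  | c :: d :: w, _ =>
    rw [chainWeight, show p - 1 = p - 2 + 1 by omega]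
    simp

/-- The chains whose first link is an ascent. -/
theorem wsum_ascent (hp : 3 ≤ p) (h0 : τ ⟨0, by omega⟩ = ⟨0, by omega⟩) {n : ℕ} (hn : 2 ≤ n) :
    wsum (range n) (fun w =>
      if w.getD 0 0 < w.getD 1 0 then (1 - z) * chainWeight τ (w.drop 1) else 0) =
      (1 - z) * wsum (range (n - 1)) (chainWeight τ) := by
  rw [wsum_cons (by simp; omega), Finset.sum_eq_single 0]
  · rw [rank_range (Nat.zero_le n), pow_zero, one_mul, wsum_congr (g := fun y => (1 - z) *
      chainWeight τ y), wsum_const_mul, wsum_eq_range _ (orderInvariant_chainWeight τ),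
      card_erase_of_mem (by simp; omega), card_range]
    intro y hy
    have hl := length_of_mem_arr hy
    rw [card_erase_of_mem (by simp; omega), card_range] at hl
    have h1 := (mem_iff_of_mem_arr hy _).1 (getD_mem_of_lt (i := 0) (by omega))
    rw [if_pos, List.drop_succ_cons, List.drop_zero]
    simpa [Nat.pos_iff_ne_zero] using (Finset.mem_erase.1 h1).1
  -- If the first letter is not `0` and an ascent follows, then `0` occurs later than the second
  -- letter, and the remaining chain has weight zero.
  · intro x hx hx0
    rw [wsum_eq_zero, mul_zero]
    intro y hy
    split_ifs with h
    · match y, hy, h with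
      | [], _, h => simp at h
      | c :: y, hy, h =>
        have hc : x < c := by simpa using h
        have h00 : 0 ∈ c :: y := (mem_iff_of_mem_arr hy 0).2 (by simp; omega)
        have h01 : 0 ∈ y := (List.mem_cons.1 h00).resolve_left (by omega)
        have : chainWeight τ (c :: y) = 0 := by
          by_contra h
          have := lt_of_chainWeight_cons_ne_zero hp h0 h h01
          omega
        simp [this]
    · rfl
  · intro h
    simp at h
    omega

theorem MatchHead.rank_eq {C : Finset ℕ} {x : List ℕ} (h : MatchHead τ x) (hx : x ∈ arr C)
    (hC : #C = p) (a : Fin p) : rank C (x.getD a 0) = (τ a : ℕ) := by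
  have hl : x.length = p := by rw [length_of_mem_arr hx, hC]
  rw [← (red_eq_iff (fun a : Fin p => x.getD a 0) τ).2 h.2 a, rank, red]
  symm
  refine Finset.card_bij (fun b _ => x.getD b 0) ?_ ?_ ?_
  · intro b hb
    rw [Finset.mem_filter] at hb ⊢
    exact ⟨(mem_iff_of_mem_arr hx _).1 (getD_mem_of_lt (by omega)), hb.2⟩
  · intro i _ j _ h1
    have hi : (i : ℕ) < x.length := by omega
    have hj : (j : ℕ) < x.length := by omega
    rw [List.getD_eq_getElem _ _ hi, List.getD_eq_getElem _ _ hj,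
      (mem_arr.1 hx).1.getElem_inj_iff] at h1
    exact Fin.ext h1
  · intro c hc
    rw [Finset.mem_filter] at hc
    obtain ⟨i, hi, rfl⟩ := List.getElem_of_mem ((mem_iff_of_mem_arr hx c).2 hc.1)
    refine ⟨⟨i, by omega⟩, ?_, by simp [hi]⟩
    simpa [hi] using hc.2

theorem rank_le (C : Finset ℕ) (x : ℕ) : rank C x ≤ x := by
  conv_rhs => rw [← card_range x]
  refine Finset.card_le_card fun y hy => ?_
  simpa using (Finset.mem_filter.1 hy).2

/-- The letters below `s` are smaller than all letters outside `C`, so they add nothing to `cross`;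
removing them leaves a free choice of `p - s` letters from `Ico s n`. -/
theorem sum_cross_of_range_subset {n s : ℕ} (hs : s ≤ p) (hn : p ≤ n) :
    ∑ C ∈ (powersetCard p (range n)).filter (range s ⊆ ·), q ^ cross C (range n \ C) =
      qBinom (n - s) (p - s) := by
  rw [← Nat.card_Ico s n, ← sum_cross]
  refine Finset.sum_bij' (fun C _ => C \ range s) (fun C _ => range s ∪ C) ?_ ?_ ?_ ?_ ?_
  · intro C hC
    rw [Finset.mem_filter, mem_powersetCard] at hC
    obtain ⟨⟨h1, h2⟩, h3⟩ := hC
    rw [mem_powersetCard, card_sdiff_of_subset h3, h2, card_range]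
    refine ⟨fun x hx => ?_, rfl⟩
    have := h1 (Finset.mem_sdiff.1 hx).1
    simp at hx this ⊢
    omega
  · intro C hC
    rw [mem_powersetCard] at hC
    obtain ⟨h1, h2⟩ := hC
    rw [Finset.mem_filter, mem_powersetCard, card_union_of_disjoint, h2, card_range]
    · refine ⟨⟨fun x hx => ?_, by omega⟩, Finset.subset_union_left⟩
      rcases Finset.mem_union.1 hx with hx | hx
      · simp at hx ⊢
        omega
      · have := h1 hx
        simp at this ⊢
        omega
    · rw [Finset.disjoint_left]
      intro x hx hx'
      have := h1 hx'
      simp at hx this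
      omega
  · intro C hC
    rw [Finset.mem_filter] at hC
    exact Finset.union_sdiff_of_subset hC.2
  · intro C hC
    rw [mem_powersetCard] at hC
    rw [Finset.union_sdiff_left]
    refine Finset.sdiff_eq_self_of_disjoint ?_
    rw [Finset.disjoint_left]
    intro x hx hx'
    have := hC.1 hx
    simp at hx' this
    omega
  · intro C hC
    rw [Finset.mem_filter, mem_powersetCard] at hC
    obtain ⟨⟨h1, h2⟩, h3⟩ := hC
    have hD : range n \ C = Ico s n \ (C \ range s) := by
      ext x
      have := @h3 x
      simp only [Finset.mem_sdiff, Finset.mem_range, Finset.mem_Ico] at this ⊢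
      constructor
      · rintro ⟨ha, hb⟩
        exact ⟨⟨by by_contra hc; exact hb (this (by omega)), ha⟩, fun hc => hb hc.1⟩
      · rintro ⟨⟨ha, hb⟩, hc⟩
        exact ⟨hb, fun hd => hc ⟨hd, by omega⟩⟩
    congr 1
    rw [cross, cross, hD, ← Finset.sum_sdiff h3, add_eq_left]
    refine Finset.sum_eq_zero fun c hc => ?_
    rw [card_eq_zero, Finset.filter_eq_empty_iff]
    intro x hx
    simp at hc hx
    omega

/-- The chains whose first link is an occurrence of `τ`. -/
theorem wsum_match (hp : 3 ≤ p) (h0 : τ ⟨0, by omega⟩ = ⟨0, by omega⟩) {s : ℕ} (hs : 1 ≤ s)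
    (hsp : s < p) (hlast : (τ ⟨p - 1, by omega⟩ : ℕ) + 1 = s) {n : ℕ} (hn : p ≤ n) :
    wsum (range n) (fun w =>
      if MatchHead τ w then z ^ des τ * chainWeight τ (w.drop (p - 1)) else 0) =
      z ^ des τ * q ^ inv τ * qBinom (n - s) (p - s) *
        wsum (range (n - p + 1)) (chainWeight τ) := by
  -- The cut is made after `p` letters, and the last letter of the match is also passed on as the
  -- head of the remaining chain.
  have hG : ∀ w ∈ arr (range n),
      (if MatchHead τ w then z ^ des τ * chainWeight τ (w.drop (p - 1)) else 0) =
      (fun x y => if MatchHead τ x then z ^ des τ * chainWeight τ (x.getD (p - 1) 0 :: y) else 0)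
        (w.take p) (w.drop p) := by
    intro w hw
    have hl : w.length = n := by simpa using length_of_mem_arr hw
    have h1 : MatchHead τ w ↔ MatchHead τ (w.take p) := by simp [matchHead_take_iff]
    have h2 : w.drop (p - 1) = (w.take p).getD (p - 1) 0 :: w.drop p := by
      have h3 : p - 1 < w.length := by omega
      have h4 : p - 1 < p := by omega
      rw [List.drop_eq_getElem_cons h3, show p - 1 + 1 = p by omega]
      simp [List.getD_eq_getElem?_getD, h3, h4]
    rw [h2]
    exact if_congr h1 rfl rfl
  rw [wsum_congr hG, wsum_split (range n) p (by simpa using hn) (fun x y => if MatchHead τ x then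
      z ^ des τ * chainWeight τ (x.getD (p - 1) 0 :: y) else 0),
    ← sum_cross_of_range_subset hsp.le hn, Finset.sum_filter, Finset.mul_sum, Finset.sum_mul]
  refine Finset.sum_congr rfl fun C hC => ?_
  rw [mem_powersetCard] at hC
  obtain ⟨hCn, hCp⟩ := hC
  have hrank : ∀ x ∈ arr C, MatchHead τ x → rank C (x.getD (p - 1) 0) = s - 1 := by
    intro x hx hm
    have := hm.rank_eq hx hCp ⟨p - 1, by omega⟩
    simp only at this
    omega
  -- The last letter of the match has rank `s - 1` in `C`. If `C` contains `range s`, no letter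
  -- outside `C` lies at or below it. Otherwise some `y < s` is outside `C`, and `y ≤ s - 1` is at
  -- most that letter, because a rank never exceeds the letter itself; the rest of the chain then
  -- has weight zero.
  by_cases hsC : range s ⊆ C
  · rw [if_pos hsC, wsum_congr (g := fun x => (if MatchHead τ x then 1 else 0) *
      (z ^ des τ * wsum (range (n - p + 1)) (chainWeight τ))), wsum_mul_const,
      wsum_matchHead τ hCp]
    · ring
    intro x hx
    split_ifs with hm
    · rw [wsum_const_mul, wsum_chainWeight_cons hp h0, card_sdiff_of_subset hCn, hCp, card_range,
        one_mul]
      intro y hy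
      have hr := hrank x hx hm
      set l := x.getD (p - 1) 0
      by_contra hly
      rw [Finset.mem_sdiff] at hy
      have hys : s ≤ y := by
        by_contra h
        exact hy.2 (hsC (by simpa using h))
      have : #(range s) ≤ rank C l := by
        refine Finset.card_le_card fun a ha => ?_
        rw [Finset.mem_filter]
        have := Finset.mem_range.1 ha
        exact ⟨hsC ha, by omega⟩
      rw [card_range] at this
      omega
    · rw [zero_mul]
      exact wsum_eq_zero fun _ _ => rfl
  · rw [if_neg hsC, mul_zero, zero_mul, wsum_eq_zero, mul_zero]
    intro x hx
    split_ifs with hm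
    · obtain ⟨y, hy, hyC⟩ := Finset.not_subset.1 hsC
      have hys := Finset.mem_range.1 hy
      have hr := hrank x hx hm
      have := rank_le C (x.getD (p - 1) 0)
      rw [wsum_const_mul, wsum_chainWeight_cons_eq_zero hp h0 (x := y), mul_zero]
      · simp [hyC]
        omega
      · omega
    · exact wsum_eq_zero fun _ _ => rfl

theorem wsum_chainWeight_recursion (hp : 3 ≤ p) (h0 : τ ⟨0, by omega⟩ = ⟨0, by omega⟩) {s : ℕ}
    (hs : 1 ≤ s) (hsp : s < p) (hlast : (τ ⟨p - 1, by omega⟩ : ℕ) + 1 = s) {n : ℕ} (hn : 2 ≤ n) :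
    wsum (range n) (chainWeight τ) =
      (1 - z) * wsum (range (n - 1)) (chainWeight τ) -
        z ^ des τ * q ^ inv τ * qBinom (n - s) (p - s) *
          wsum (range (n - p + 1)) (chainWeight τ) := by
  have hl : ∀ w ∈ arr (range n), w.length = n := fun w hw => by simpa using length_of_mem_arr hw
  rw [wsum_congr fun w hw => chainWeight_of_two_le_length hp (hn.trans_eq (hl w hw).symm),
    ← wsum_ascent hp h0 hn]
  have hsub : ∀ f g : List ℕ → K, wsum (range n) (fun w => f w - g w) =
      wsum (range n) f - wsum (range n) g := fun f g => by
    simp only [wsum, mul_sub, Finset.sum_sub_distrib]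
  rw [hsub]
  congr 1
  by_cases hpn : p ≤ n
  · exact wsum_match hp h0 hs hsp hlast hpn
  -- For `n < p` no match fits, and `n - s < p - s` holds even when `n - s` is truncated, since `s <
  -- p`.
  · rw [qBinom, if_neg (by omega), mul_zero, zero_mul]
    refine wsum_eq_zero fun w hw => if_neg fun h => hpn ?_
    rw [← hl w hw]
    exact h.1

/-! ### Generating functions and the inverse series. -/

/-- The exponential generating function of the chain weights. -/
noncomputable def chainSeries (τ : Equiv.Perm (Fin p)) : PowerSeries K :=
  PowerSeries.mk fun n => wsum (range n) (chainWeight τ) / qFactorial n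

theorem INM_eq (hp : 3 ≤ p) : INM τ =
    PowerSeries.mk fun n => wsum (range n) (nmWeight τ) / qFactorial n := by
  ext n
  rw [INM, PowerSeries.coeff_mk, PowerSeries.coeff_mk]
  split_ifs with h
  · subst h
    simp [wsum, nmWeight, invL, qFactorial]
  · rw [INMcoeff_eq_wsum (by omega) τ (by omega)]

/-- After multiplication by `qFactorial n`, the coefficient at `n ≥ 1` is a sum over words and cuts;
exchanging the two sums lets it vanish word by word. -/
theorem chainSeries_mul_INM (hp : 3 ≤ p) (h0 : τ ⟨0, by omega⟩ = ⟨0, by omega⟩)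
    (hτ : NonOverlapping τ) : chainSeries τ * INM τ = 1 := by
  ext n
  rw [INM_eq hp, chainSeries, PowerSeries.coeff_mul, PowerSeries.coeff_one]
  simp only [PowerSeries.coeff_mk]
  rw [Finset.Nat.sum_antidiagonal_eq_sum_range_succ fun i j =>
    wsum (range i) (chainWeight τ) / qFactorial i * (wsum (range j) (nmWeight τ) / qFactorial j)]
  split_ifs with hn
  · subst hn
    simp [wsum, nmWeight, chainWeight, invL, qFactorial]
  · have hterm : ∀ k ∈ range (n + 1),
        wsum (range k) (chainWeight τ) / qFactorial k *
          (wsum (range (n - k)) (nmWeight τ) / qFactorial (n - k)) =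
        wsum (range n) (fun w => chainWeight τ (w.take k) * nmWeight τ (w.drop k)) /
          qFactorial n := by
      intro k hk
      have hk' : k ≤ n := Nat.lt_succ_iff.1 (Finset.mem_range.1 hk)
      rw [wsum_take_mul_drop (orderInvariant_chainWeight τ) (orderInvariant_nmWeight τ) hk',
        qBinom, if_pos hk']
      have h1 := qFactorial_ne_zero n
      have h2 := qFactorial_ne_zero k
      have h3 := qFactorial_ne_zero (n - k)
      field_simp
    rw [Finset.sum_congr rfl hterm, ← Finset.sum_div]
    have hzero : ∑ k ∈ range (n + 1),
        wsum (range n) (fun w => chainWeight τ (w.take k) * nmWeight τ (w.drop k)) = 0 := by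
      simp only [wsum]
      rw [Finset.sum_comm]
      refine Finset.sum_eq_zero fun w hw => ?_
      have hl : w.length = n := by simpa using length_of_mem_arr hw
      rw [← Finset.mul_sum, ← hl, sum_chainWeight_mul_nmWeight hp h0 hτ w (mem_arr.1 hw).1,
        mul_zero]
      rintro rfl
      exact hn hl.symm
    rw [hzero, zero_div]

theorem constantCoeff_INM : PowerSeries.constantCoeff (INM τ) = 1 := by
  rw [← PowerSeries.coeff_zero_eq_constantCoeff_apply]
  simp [INM]

theorem INM_mul_IU : INM τ * IU τ = 1 :=
  PowerSeries.mul_inv_cancel _ (by rw [constantCoeff_INM]; exact one_ne_zero)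

theorem IU_eq_chainSeries (hp : 3 ≤ p) (h0 : τ ⟨0, by omega⟩ = ⟨0, by omega⟩)
    (hτ : NonOverlapping τ) : IU τ = chainSeries τ := by
  rw [← one_mul (IU τ), ← chainSeries_mul_INM hp h0 hτ, mul_assoc, INM_mul_IU, mul_one]

theorem IUcoeff_eq_wsum (hp : 3 ≤ p) (h0 : τ ⟨0, by omega⟩ = ⟨0, by omega⟩)
    (hτ : NonOverlapping τ) (n : ℕ) : IUcoeff τ n = wsum (range n) (chainWeight τ) := by
  rw [IUcoeff, IU_eq_chainSeries hp h0 hτ, chainSeries, PowerSeries.coeff_mk,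
    mul_div_cancel₀ _ (qFactorial_ne_zero n)]

end

end MinOverlap

/-- In the recursion, the subtractions in `ℕ` do no harm: for `n < p` the `q`-binomial coefficient
`qBinom (n - s) (p - s)` is `0`, and for `n ≥ p` all the differences are the true ones. -/
theorem theorem4p1 (p s : ℕ) (hs : 2 ≤ s) (hsp : s < p) (τ : Equiv.Perm (Fin p))
    (hτ : MinOverlap.IsMinimalOverlapping τ)
    (hfirst : (τ ⟨0, Nat.zero_lt_of_lt hsp⟩ : ℕ) + 1 = 1)
    (hlast : (τ ⟨p - 1, Nat.sub_one_lt_of_lt hsp⟩ : ℕ) + 1 = s) :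
    MinOverlap.INM τ * MinOverlap.IU τ = 1 ∧
    MinOverlap.INM τ = (MinOverlap.IU τ)⁻¹ ∧
    MinOverlap.IU τ = PowerSeries.mk (fun n =>
      if n = 0 then 1 else MinOverlap.IUcoeff τ n / MinOverlap.qFactorial n) ∧
    MinOverlap.IUcoeff τ 1 = -MinOverlap.z ∧
    ∀ n : ℕ, 2 ≤ n →
      MinOverlap.IUcoeff τ n =
        (1 - MinOverlap.z) * MinOverlap.IUcoeff τ (n - 1)
          - MinOverlap.z ^ MinOverlap.des τ * MinOverlap.q ^ MinOverlap.inv τ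
            * MinOverlap.qBinom (n - s) (p - s) * MinOverlap.IUcoeff τ (n - p + 1) := by
  have hp : 3 ≤ p := hτ.1
  have h0 : τ ⟨0, by omega⟩ = ⟨0, by omega⟩ := Fin.ext (by simpa using hfirst)
  have hno := hτ.nonOverlapping
  have hU := MinOverlap.IUcoeff_eq_wsum hp h0 hno
  have hcc : PowerSeries.constantCoeff (MinOverlap.IU τ) = 1 := by
    have := congrArg PowerSeries.constantCoeff (MinOverlap.INM_mul_IU (τ := τ))
    simpa [MinOverlap.constantCoeff_INM] using this
  refine ⟨MinOverlap.INM_mul_IU, ?_, ?_, ?_, ?_⟩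
  · rw [PowerSeries.eq_inv_iff_mul_eq_one (by rw [hcc]; exact one_ne_zero)]
    exact MinOverlap.INM_mul_IU
  · ext n
    rw [PowerSeries.coeff_mk]
    split_ifs with hn
    · rw [hn, PowerSeries.coeff_zero_eq_constantCoeff_apply, hcc]
    · rw [MinOverlap.IUcoeff, mul_div_cancel_left₀ _ (MinOverlap.qFactorial_ne_zero n)]
  · rw [hU, Finset.range_one, MinOverlap.wsum, MinOverlap.arr_singleton]
    simp [MinOverlap.invL, MinOverlap.chainWeight]
  · intro n hn
    simp only [hU]
    exact MinOverlap.wsum_chainWeight_recursion hp h0 (by omega) hsp hlast hn
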